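/- \textbf{Setting.} $\lambda$-terms are finite and taken modulo renaming of bound variables; $\to$ is one-step $\beta$-reduction, $\to^n$ its $n$-fold composition, and $N$ is a \emph{reduct} of $M$ if $M\to^n N$ for some $n\in\mathbb N$. A \emph{head step} is a step $\lambda x_1\ldots x_n.(\lambda y.P)Q\,N_1\ldots N_m\to_h\lambda x_1\ldots x_n.(P[y:=Q])N_1\ldots N_m$ $(n,m\ge 0)$; a \emph{head normal form (hnf)} is a term $\lambda x_1\ldots x_n.\,y\,M_1\ldots M_m$ $(n,m\ge 0)$, and a term \emph{has an hnf} if it has a reduct that is an hnf (in which case its head reduction ends in an hnf). A redex $(\lambda x.P)Q$ is \emph{simple} if $x$ has at most one free occurrence in $P$ or $Q$ is a $\beta$-normal form. The set of \emph{simple terms} is the largest set $X$ of $\lambda$-terms such that, for every $M\in X$, either $M$ has no hnf, or the head reduction of $M$ to an hnf $\lambda x_1\ldots x_n.\,y\,M_1\ldots M_m$ contracts only simple redexes and $M_1,\ldots,M_m\in X$. The \emph{clocked Böhm tree} $\mathrm{BT}_c(M)$ is the potentially infinite term over variables, abstraction, application and $\bot$, with some subterms annotated by natural numbers, that is defined coinductively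 as follows. If $M$ has no hnf, then $\mathrm{BT}_c(M)=\bot$ (not annotated). If $M$ head reduces in exactly $k$ steps to the hnf $\lambda x_1\ldots x_n.\,y\,M_1\ldots M_m$, then $\mathrm{BT}_c(M)$ is $\lambda x_1\ldots x_n.\,y\,\mathrm{BT}_c(M_1)\ldots\mathrm{BT}_c(M_m)$ with its root annotated by $k$. Positions are finite sequences over $\{0,1,2\}$, where $0$ leads to the body of an abstraction and $1$, $2$ lead to the function and the argument of an application. The annotations of two trees \emph{agree} at a position $p$ of both if the two subterms at $p$ are both not annotated or both annotated with the same number; otherwise they \emph{differ} at $p$. Terms $M$ and $N$ \emph{match eventually} if $\mathrm{BT}_c(M)$ and $\mathrm{BT}_c(N)$ become equal when all annotations are dropped, and there is $\ell\in\mathbb N$ such that their annotations agree at all positions of length at least $\ell$. \textbf{Proposition.} Let $M$ be a simple term and let $N$ be a reduct of $M$. Then $M$ and $N$ match eventually. Moreover, the annotations of $\mathrm{BT}_c(M)$ and $\mathrm{BT}_c(N)$ differ at only finitely many positions, and at no more than $n$ positions whenever $M\to^n N$. -/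

import Mathlib

namespace ClockedBohm

/-- Finite λ-terms modulo renaming of bound variables, in de Bruijn notation:
a free variable is an index pointing beyond all enclosing abstractions. -/
inductive Term : Type
  | var (i : ℕ) : Term
  | lam (M : Term) : Term
  | app (M N : Term) : Term

namespace Term

instance : Inhabited Term := ⟨var 0⟩

/-- Extension of a renaming under a binder. -/
def upr (ξ : ℕ → ℕ) : ℕ → ℕ
  | 0 => 0
  | i + 1 => ξ i + 1

def rename : Term → (ℕ → ℕ) → Term
  | var i, ξ => var (ξ i)
  | lam M, ξ => lam (M.rename (upr ξ))
  | app M N, ξ => app (M.rename ξ) (N.rename ξ)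

/-- Extension of a substitution under a binder. -/
def ups (σ : ℕ → Term) : ℕ → Term
  | 0 => var 0
  | i + 1 => (σ i).rename Nat.succ

/-- Simultaneous capture-avoiding substitution. -/
def subst : Term → (ℕ → Term) → Term
  | var i, σ => σ i
  | lam M, σ => lam (M.subst (ups σ))
  | app M N, σ => app (M.subst σ) (N.subst σ)

/-- The substitution replacing index `0` by `N` and lowering all other indices. -/
def single (N : Term) : ℕ → Term
  | 0 => N
  | i + 1 => var i

/-- The contractum `M[x := N]` of the redex `(λx.M) N`. -/
def inst (M N : Term) : Term := M.subst (single N)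

/-- Number of free occurrences of the variable with index `i`. -/
def occ : Term → ℕ → ℕ
  | var j, i => if j = i then 1 else 0
  | lam M, i => M.occ (i + 1)
  | app M N, i => M.occ i + N.occ i

/-- `λx₁…xₙ. M`. -/
def lams : ℕ → Term → Term
  | 0, M => M
  | n + 1, M => lam (lams n M)

/-- `M N₁ … Nₘ`. -/
def apps (M : Term) (Ns : List Term) : Term := Ns.foldl app M

end Term

open Term

/-- One-step β-reduction. -/
inductive Beta : Term → Term → Prop
  | beta (M N : Term) : Beta (app (lam M) N) (M.inst N)
  | lam {M M' : Term} : Beta M M' → Beta (lam M) (lam M')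
  | appL {M M' : Term} (N : Term) : Beta M M' → Beta (app M N) (app M' N)
  | appR (M : Term) {N N' : Term} : Beta N N' → Beta (app M N) (app M N')

/-- The `n`-fold composition of a relation. -/
def Steps (r : Term → Term → Prop) : ℕ → Term → Term → Prop
  | 0, M, N => M = N
  | n + 1, M, N => ∃ P, r M P ∧ Steps r n P N

/-- `N` is a reduct of `M`. -/
def Reduces (M N : Term) : Prop := ∃ n, Steps Beta n M N

def IsNormal (M : Term) : Prop := ∀ N, ¬ Beta M N

/-- Head normal forms `λx₁…xₙ. y M₁ … Mₘ`. -/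
def IsHnf (M : Term) : Prop := ∃ (n y : ℕ) (Ms : List Term), M = lams n (apps (var y) Ms)

def HasHnf (M : Term) : Prop := ∃ H, Reduces M H ∧ IsHnf H

/-- `M → M'` is a head step contracting the redex `(λ.P) Q`. -/
def HeadStepOf (P Q M M' : Term) : Prop :=
  ∃ (n : ℕ) (Ns : List Term),
    M = lams n (apps (app (lam P) Q) Ns) ∧ M' = lams n (apps (P.inst Q) Ns)

def HeadStep (M M' : Term) : Prop := ∃ P Q, HeadStepOf P Q M M'

/-- The redex `(λ.P) Q` is linear. -/
def LinearRedex (P _Q : Term) : Prop := P.occ 0 ≤ 1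

/-- The redex `(λ.P) Q` is call-by-value. -/
def CbvRedex (_P Q : Term) : Prop := IsNormal Q

/-- The redex `(λ.P) Q` is simple. -/
def SimpleRedex (P Q : Term) : Prop := LinearRedex P Q ∨ CbvRedex P Q

/-- A head step that contracts a simple redex. -/
def SimpleHeadStep (M M' : Term) : Prop := ∃ P Q, SimpleRedex P Q ∧ HeadStepOf P Q M M'

/-- The closure condition in the coinductive definition of simple terms. -/
def SimpleClosed (X : Set Term) : Prop :=
  ∀ M ∈ X, ¬ HasHnf M ∨
    ∃ (k n y : ℕ) (Ms : List Term),
      Steps SimpleHeadStep k M (lams n (apps (var y) Ms)) ∧ ∀ M' ∈ Ms, M' ∈ X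

/-- Simple terms: the largest set satisfying `SimpleClosed`. -/
def Simple (M : Term) : Prop := ∃ X : Set Term, SimpleClosed X ∧ M ∈ X

/-- Symbols of (potentially infinite) λ-terms with `⊥`. -/
inductive Sym : Type
  | var (i : ℕ) : Sym
  | lam : Sym
  | app : Sym
  | bot : Sym

/-- The directions in which a node has children: `0` for the body of an abstraction,
`1` and `2` for the function and the argument of an application. -/
def Sym.dirs : Sym → Set (Fin 3)
  | .var _ => ∅
  | .lam => {0}
  | .app => {1, 2}
  | .bot => ∅

/-- Signature of λ-terms with `⊥` in which every node also carries an element of `A`. -/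
def treeF (A : Type) : PFunctor.{0, 0} := ⟨A × Sym, fun a => {d : Fin 3 // d ∈ a.2.dirs}⟩

/-- Finite and infinite λ-terms with `⊥` (coinductively), each node carrying an element of `A`. -/
abbrev Tree (A : Type) : Type := (treeF A).M

/-- Annotated terms; `none` at a node means that the subterm there is not annotated. -/
abbrev AnnTree : Type := Tree (Option ℕ)

/-- Drop all annotations. -/
def deannotate : AnnTree → Tree Unit :=
  PFunctor.M.corec fun T => ⟨((), T.dest.1.2), T.dest.2⟩

/-- Positions are sequences over `{0, 1, 2}`. -/
abbrev Position : Type := List (Fin 3)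

open Classical in
/-- The subterm at a position, if defined. -/
noncomputable def subtreeAt {A : Type} : Tree A → Position → Option (Tree A)
  | T, [] => some T
  | T, d :: p => if h : d ∈ T.dest.1.2.dirs then subtreeAt (T.dest.2 ⟨d, h⟩) p else none

/-- The set of positions of a tree. -/
def positions {A : Type} (T : Tree A) : Set Position := {p | (subtreeAt T p).isSome}

/-- The annotation at the root, if any. -/
def rootAnn (T : AnnTree) : Option ℕ := T.dest.1.1

/-- `T₁` and `T₂` are related by `R` at the (common) position `p`: the subterms there are both not
annotated, or both annotated with `R`-related numbers. -/
def RelAt (R : ℕ → ℕ → Prop) (p : Position) (T₁ T₂ : AnnTree) : Prop :=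
  ∃ S₁ S₂, subtreeAt T₁ p = some S₁ ∧ subtreeAt T₂ p = some S₂ ∧
    ((rootAnn S₁ = none ∧ rootAnn S₂ = none) ∨
      ∃ k₁ k₂, rootAnn S₁ = some k₁ ∧ rootAnn S₂ = some k₂ ∧ R k₁ k₂)

/-- `R` holds eventually between `T₁` and `T₂`. -/
def RelEventually (R : ℕ → ℕ → Prop) (T₁ T₂ : AnnTree) : Prop :=
  deannotate T₁ = deannotate T₂ ∧
    ∃ l : ℕ, ∀ p ∈ positions T₁, l ≤ p.length → RelAt R p T₁ T₂

/-- The positions at which the annotations of `T₁` and `T₂` differ. -/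
def differingPositions (T₁ T₂ : AnnTree) : Set Position :=
  {p | p ∈ positions T₁ ∪ positions T₂ ∧ ¬ RelAt Eq p T₁ T₂}

/-- States in the generation of a clocked Böhm tree: `eval M` stands for the clocked Böhm tree of
`M`; `inner H` stands for a proper part `λxᵢ…xₙ. y M₁ … Mⱼ` of a head normal form that is already
computed, in which only the `Mᵢ` have still to be replaced by their clocked Böhm trees. -/
inductive State : Type
  | eval (M : Term) : State
  | inner (H : Term) : State

/-- Output the root of `H` with annotation `a`. -/
def emit (a : Option ℕ) : Term → (treeF (Option ℕ)) State
  | .var i => ⟨(a, .var i), fun d => (Set.notMem_empty d.1 d.2).elim⟩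
  | .lam H => ⟨(a, .lam), fun _ => .inner H⟩
  | .app H M => ⟨(a, .app), fun d => if d.1 = 1 then .inner H else .eval M⟩

/-- The length `k` and the result `H` of the head reduction of `M` to head normal form. These exist
uniquely if `M` has a head normal form. -/
noncomputable def headReduction (M : Term) : ℕ × Term :=
  Classical.epsilon fun kH : ℕ × Term => Steps HeadStep kH.1 M kH.2 ∧ IsHnf kH.2

open Classical in
noncomputable def cbtStep : State → (treeF (Option ℕ)) State
  | .eval M =>
      if HasHnf M then emit (some (headReduction M).1) (headReduction M).2
      else ⟨(none, .bot), fun d => (Set.notMem_empty d.1 d.2).elim⟩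
  | .inner H => emit none H

/-- The clocked Böhm tree of `M`: it is `⊥` if `M` has no head normal form; otherwise, if
`M` head reduces in `k` steps to the head normal form `λx₁…xₙ. y M₁ … Mₘ`, it is
`λx₁…xₙ. y T₁ … Tₘ` with root annotation `k`, where `Tᵢ` is the clocked Böhm tree of `Mᵢ`. -/
noncomputable def clockedBohmTree (M : Term) : AnnTree :=
  PFunctor.M.corec cbtStep (.eval M)

/-- `M` matches `N` eventually. -/
def MatchesEventually (M N : Term) : Prop :=
  RelEventually Eq (clockedBohmTree M) (clockedBohmTree N)

end ClockedBohm

namespace ClockedBohm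

namespace Term

/-! ### Substitution calculus -/

/-! The reduction from `M` to `N` is a budget, and every differing annotation costs at least one of
its steps. Take a simple head step from `M` to `M'` and a reduction of `n` steps from `M` to `N`. If
the head redex survives in `N`, contracting it there gives a common target `N'`, and at most `n`
steps lead from `M'` to `N'`: a simple redex uses its argument at most once or has an argument
without steps, so nothing is duplicated. If the head redex was contracted on the way, `M'` reduces
to `N` in at most `n - 1` steps (`WeakHead.project`).

Iterating (`Steps.project_head`), if `M` reaches its hnf `H` in `k` head steps, then `N` reaches
some `N'` in `k' ≤ k` head steps, and `H` reduces to `N'` in at most `n - (k - k')` steps. Reduction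
preserves the shape of an hnf, so `N'` is the hnf of `N`, and the remaining steps split among the
arguments, which are again simple. The root annotations differ only if `k' < k`, which costs at
least one step. This invariant is `IsBudgeted`; it bounds the number of differing positions by `n`
(`IsBudgeted.encard_le`), and finiteness gives eventual matching. Confluence is not needed. -/

theorem rename_congr {ξ ζ : ℕ → ℕ} (h : ∀ i, ξ i = ζ i) (M : Term) : M.rename ξ = M.rename ζ := by
  rw [funext h]

theorem subst_congr {σ τ : ℕ → Term} (h : ∀ i, σ i = τ i) (M : Term) : M.subst σ = M.subst τ := by
  rw [funext h]

theorem rename_rename (M : Term) (ξ ζ : ℕ → ℕ) :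
    (M.rename ξ).rename ζ = M.rename fun i => ζ (ξ i) := by
  induction M generalizing ξ ζ with
  | var i => rfl
  | lam M ih =>
    simp only [rename, ih]
    congr 1
    exact rename_congr (fun i => by cases i <;> rfl) M
  | app M N ihM ihN => simp only [rename, ihM, ihN]

theorem subst_rename (M : Term) (ξ : ℕ → ℕ) (σ : ℕ → Term) :
    (M.rename ξ).subst σ = M.subst fun i => σ (ξ i) := by
  induction M generalizing ξ σ with
  | var i => rfl
  | lam M ih =>
    simp only [rename, subst, ih]
    congr 1
    exact subst_congr (fun i => by cases i <;> rfl) M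
  | app M N ihM ihN => simp only [rename, subst, ihM, ihN]

theorem rename_subst (M : Term) (σ : ℕ → Term) (ξ : ℕ → ℕ) :
    (M.subst σ).rename ξ = M.subst fun i => (σ i).rename ξ := by
  induction M generalizing ξ σ with
  | var i => rfl
  | lam M ih =>
    simp only [rename, subst, ih]
    congr 1
    refine subst_congr (fun i => ?_) M
    cases i with
    | zero => rfl
    | succ i =>
      simp only [ups, rename_rename]
      rfl
  | app M N ihM ihN => simp only [rename, subst, ihM, ihN]

theorem subst_subst (M : Term) (σ τ : ℕ → Term) :
    (M.subst σ).subst τ = M.subst fun i => (σ i).subst τ := by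
  induction M generalizing σ τ with
  | var i => rfl
  | lam M ih =>
    simp only [subst, ih]
    congr 1
    refine subst_congr (fun i => ?_) M
    cases i with
    | zero => rfl
    | succ i =>
      simp only [ups, subst_rename, rename_subst]
  | app M N ihM ihN => simp only [subst, ihM, ihN]

theorem subst_var (M : Term) : M.subst var = M := by
  induction M with
  | var i => rfl
  | lam M ih =>
    simp only [subst]
    rw [subst_congr (τ := var) (fun i => by cases i <;> rfl), ih]
  | app M N ihM ihN => simp only [subst, ihM, ihN]

theorem inst_rename (M N : Term) (ξ : ℕ → ℕ) :
    (M.inst N).rename ξ = (M.rename (upr ξ)).inst (N.rename ξ) := by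
  simp only [inst, rename_subst, subst_rename]
  exact subst_congr (fun i => by cases i <;> rfl) M

theorem inst_subst (M N : Term) (σ : ℕ → Term) :
    (M.inst N).subst σ = (M.subst (ups σ)).inst (N.subst σ) := by
  simp only [inst, subst_subst]
  refine subst_congr (fun i => ?_) M
  cases i with
  | zero => rfl
  | succ i =>
    simp only [ups, single, subst_rename]
    exact (subst_var (σ i)).symm

theorem apps_concat (M : Term) (Ns : List Term) (N : Term) :
    apps M (Ns ++ [N]) = app (apps M Ns) N := by
  simp [apps]

end Term

open Term

theorem Beta.rename {M M' : Term} (h : Beta M M') (ξ : ℕ → ℕ) :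
    Beta (M.rename ξ) (M'.rename ξ) := by
  induction h generalizing ξ with
  | beta M N => rw [inst_rename]; exact .beta _ _
  | lam _ ih => exact .lam (ih _)
  | appL N _ ih => exact .appL _ (ih _)
  | appR M _ ih => exact .appR _ (ih _)

theorem Beta.subst {M M' : Term} (h : Beta M M') (σ : ℕ → Term) :
    Beta (M.subst σ) (M'.subst σ) := by
  induction h generalizing σ with
  | beta M N => rw [inst_subst]; exact .beta _ _
  | lam _ ih => exact .lam (ih _)
  | appL N _ ih => exact .appL _ (ih _)
  | appR M _ ih => exact .appR _ (ih _)

theorem subst_eq_of_occ_eq_zero (P : Term) (i : ℕ) (σ τ : ℕ → Term)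
    (h : ∀ j, j ≠ i → σ j = τ j) (hP : P.occ i = 0) : P.subst σ = P.subst τ := by
  induction P generalizing i σ τ with
  | var j =>
    refine h j fun hj => ?_
    simp [occ, hj] at hP
  | lam P ih =>
    simp only [Term.subst]
    rw [ih (i + 1) (ups σ) (ups τ) _ hP]
    rintro (_ | j) hj
    · rfl
    · simp only [ups]; rw [h j (by omega)]
  | app P Q ihP ihQ =>
    simp only [occ, Nat.add_eq_zero_iff] at hP
    simp only [Term.subst, ihP i σ τ h hP.1, ihQ i σ τ h hP.2]

/-- With a single occurrence, only one side of each application changes, so one step on the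
substituted term remains one step. Arbitrary substitutions that differ only at `i` let the induction
pass under binders. -/
theorem beta_subst_of_occ_eq_one (P : Term) (i : ℕ) (σ τ : ℕ → Term)
    (h : ∀ j, j ≠ i → σ j = τ j) (hi : Beta (σ i) (τ i)) (hP : P.occ i = 1) :
    Beta (P.subst σ) (P.subst τ) := by
  induction P generalizing i σ τ with
  | var j =>
    have hj : j = i := by
      by_contra hj
      simp [occ, hj] at hP
    subst hj
    exact hi
  | lam P ih =>
    refine .lam (ih (i + 1) (ups σ) (ups τ) ?_ (hi.rename _) hP)
    rintro (_ | j) hj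
    · rfl
    · simp only [ups]; rw [h j (by omega)]
  | app P Q ihP ihQ =>
    simp only [occ] at hP
    simp only [Term.subst]
    rcases Nat.add_eq_one_iff.mp hP with ⟨h0, h1⟩ | ⟨h1, h0⟩
    · rw [subst_eq_of_occ_eq_zero P i σ τ h h0]
      exact .appR _ (ihQ i σ τ h hi h1)
    · rw [subst_eq_of_occ_eq_zero Q i σ τ h h0]
      exact .appL _ (ihP i σ τ h hi h1)

/-! ### Iterated steps -/

theorem Steps.trans {r : Term → Term → Prop} {m n : ℕ} {M N P : Term} (h : Steps r m M N)
    (h' : Steps r n N P) : Steps r (m + n) M P := by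
  induction m generalizing M with
  | zero => cases h; rwa [Nat.zero_add]
  | succ m ih =>
    obtain ⟨Q, hQ, h⟩ := h
    rw [Nat.succ_add]
    exact ⟨Q, hQ, ih h⟩

theorem Steps.single {r : Term → Term → Prop} {M N : Term} (h : r M N) : Steps r 1 M N :=
  ⟨N, h, rfl⟩

theorem Steps.map {r s : Term → Term → Prop} (f : Term → Term)
    (hf : ∀ {M N}, r M N → s (f M) (f N)) {n : ℕ} {M N : Term} (h : Steps r n M N) :
    Steps s n (f M) (f N) := by
  induction n generalizing M with
  | zero => exact congrArg f h
  | succ n ih =>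
    obtain ⟨P, hP, h⟩ := h
    exact ⟨f P, hf hP, ih h⟩

theorem Steps.app {m n : ℕ} {M M' N N' : Term} (h : Steps Beta m M M') (h' : Steps Beta n N N') :
    Steps Beta (m + n) (app M N) (app M' N') :=
  (h.map (Term.app · N) (.appL N)).trans (h'.map (Term.app M') (.appR M'))

theorem IsNormal.eq_of_steps {n : ℕ} {M N : Term} (hM : IsNormal M) (h : Steps Beta n M N) :
    M = N := by
  cases n with
  | zero => exact h
  | succ n => obtain ⟨P, hP, -⟩ := h; exact (hM P hP).elim

/-- Contracting a simple redex duplicates no step inside its components. -/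
theorem SimpleRedex.steps_inst {P Q P' Q' : Term} {a b : ℕ} (hS : SimpleRedex P Q)
    (hP : Steps Beta a P P') (hQ : Steps Beta b Q Q') :
    ∃ m ≤ a + b, Steps Beta m (P.inst Q) (P'.inst Q') := by
  have hP' : Steps Beta a (P.inst Q') (P'.inst Q') := hP.map (inst · Q') (·.subst _)
  have agree : ∀ A B : Term, ∀ j, j ≠ 0 → Term.single A j = Term.single B j := by
    rintro A B (_ | j) hj
    · exact (hj rfl).elim
    · rfl
  rcases hS with hS | hS
  · rcases Nat.le_one_iff_eq_zero_or_eq_one.mp hS with h0 | h1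
    -- The argument is erased, and its `b` steps with it.
    · refine ⟨a, Nat.le_add_right _ _, ?_⟩
      have e : P.inst Q = P.inst Q' := subst_eq_of_occ_eq_zero P 0 _ _ (agree Q Q') h0
      rwa [e]
    · refine ⟨b + a, by omega, Steps.trans ?_ hP'⟩
      exact hQ.map (P.inst ·) fun {A B} hAB =>
        beta_subst_of_occ_eq_one P 0 _ _ (agree A B) hAB h1
  -- A normal argument has no steps to duplicate.
  · have e := IsNormal.eq_of_steps hS hQ
    exact ⟨a, Nat.le_add_right _ _, e ▸ hP'⟩

theorem Steps.lam_inv {n : ℕ} {M N : Term} (h : Steps Beta n (lam M) N) :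
    ∃ M', N = lam M' ∧ Steps Beta n M M' := by
  induction n generalizing M with
  | zero => exact ⟨M, h.symm, rfl⟩
  | succ n ih =>
    obtain ⟨P, hP, h⟩ := h
    cases hP with
    | lam hP =>
      obtain ⟨M', rfl, hsteps⟩ := ih h
      exact ⟨M', rfl, _, hP, hsteps⟩

/-- A reduction from an application either leaves the root alone or contracts it at some point. -/
theorem Steps.app_inv {n : ℕ} {M A N : Term} (h : Steps Beta n (.app M A) N) :
    (∃ a b M' A', a + b = n ∧ N = .app M' A' ∧ Steps Beta a M M' ∧ Steps Beta b A A') ∨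
    ∃ a b c B A', a + b + c + 1 = n ∧ Steps Beta a M (lam B) ∧ Steps Beta b A A' ∧
      Steps Beta c (B.inst A') N := by
  induction n generalizing M A with
  | zero => exact .inl ⟨0, 0, M, A, rfl, h.symm, rfl, rfl⟩
  | succ n ih =>
    obtain ⟨P, hP, h⟩ := h
    cases hP with
    | beta B _ => exact .inr ⟨0, 0, n, B, A, by omega, rfl, rfl, h⟩
    | appL _ hP =>
      rcases ih h with ⟨a, b, M', A', e, rfl, ha, hb⟩ | ⟨a, b, c, B, A', e, ha, hb, hc⟩
      · exact .inl ⟨a + 1, b, M', A', by omega, rfl, ⟨_, hP, ha⟩, hb⟩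
      · exact .inr ⟨a + 1, b, c, B, A', by omega, ⟨_, hP, ha⟩, hb, hc⟩
    | appR _ hP =>
      rcases ih h with ⟨a, b, M', A', e, rfl, ha, hb⟩ | ⟨a, b, c, B, A', e, ha, hb, hc⟩
      · exact .inl ⟨a, b + 1, M', A', by omega, rfl, ha, ⟨_, hP, hb⟩⟩
      · exact .inr ⟨a, b + 1, c, B, A', by omega, ha, ⟨_, hP, hb⟩, hc⟩

/-! ### Head reduction and head normal forms, inductively -/

/-- Weak head steps contracting a redex `(λ.P) Q` with `S P Q`. -/
inductive WeakHead (S : Term → Term → Prop) : Term → Term → Prop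
  | beta {P Q : Term} : S P Q → WeakHead S (.app (.lam P) Q) (P.inst Q)
  | app {M P : Term} (N : Term) : WeakHead S M P → WeakHead S (.app M N) (.app P N)

/-- Head steps contracting a redex `(λ.P) Q` with `S P Q`. -/
inductive Head (S : Term → Term → Prop) : Term → Term → Prop
  | weak {M M' : Term} : WeakHead S M M' → Head S M M'
  | lam {M M' : Term} : Head S M M' → Head S (.lam M) (.lam M')

/-- Lets head steps be analysed by structural induction instead of through lists of abstractions and
arguments. Taking `SimpleRedex` or the always true relation for `S` covers both kinds of head step.
-/
theorem head_iff {S : Term → Term → Prop} {M M' : Term} :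
    Head S M M' ↔ ∃ P Q, S P Q ∧ HeadStepOf P Q M M' := by
  constructor
  · intro h
    induction h with
    | weak h =>
      suffices ∃ P Q Ns, S P Q ∧ _ = apps (.app (.lam P) Q) Ns ∧ _ = apps (P.inst Q) Ns by
        obtain ⟨P, Q, Ns, hS, e, e'⟩ := this
        exact ⟨P, Q, hS, 0, Ns, e, e'⟩
      induction h with
      | beta hS => exact ⟨_, _, [], hS, rfl, rfl⟩
      | app N _ ih =>
        obtain ⟨P, Q, Ns, hS, rfl, rfl⟩ := ih
        exact ⟨P, Q, Ns ++ [N], hS, (apps_concat _ _ _).symm, (apps_concat _ _ _).symm⟩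
    | lam _ ih =>
      obtain ⟨P, Q, hS, n, Ns, rfl, rfl⟩ := ih
      exact ⟨P, Q, hS, n + 1, Ns, rfl, rfl⟩
  · rintro ⟨P, Q, hS, n, Ns, rfl, rfl⟩
    induction n with
    | zero =>
      refine .weak ?_
      simp only [lams]
      induction Ns using List.reverseRecOn with
      | nil => exact .beta hS
      | append_singleton Ns N ih =>
        rw [apps_concat, apps_concat]
        exact .app N ih
    | succ n ih => exact .lam ih

theorem headStep_iff {M M' : Term} : HeadStep M M' ↔ Head (fun _ _ => True) M M' := by
  simp [head_iff, HeadStep]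

theorem WeakHead.beta_step {S : Term → Term → Prop} {M M' : Term} (h : WeakHead S M M') :
    Beta M M' := by
  induction h with
  | beta _ => exact .beta _ _
  | app N _ ih => exact .appL N ih

theorem Head.beta_step {S : Term → Term → Prop} {M M' : Term} (h : Head S M M') : Beta M M' := by
  induction h with
  | weak h => exact h.beta_step
  | lam _ ih => exact .lam ih

theorem WeakHead.deterministic {S : Term → Term → Prop} {M M₁ M₂ : Term}
    (h₁ : WeakHead S M M₁) (h₂ : WeakHead S M M₂) : M₁ = M₂ := by
  induction h₁ generalizing M₂ with
  | beta _ =>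
    cases h₂ with
    | beta _ => rfl
    | app _ h => cases h
  | app N h ih =>
    cases h₂ with
    | beta _ => cases h
    | app _ h' => rw [ih h']

theorem Head.deterministic {S : Term → Term → Prop} {M M₁ M₂ : Term}
    (h₁ : Head S M M₁) (h₂ : Head S M M₂) : M₁ = M₂ := by
  induction h₁ generalizing M₂ with
  | weak h =>
    cases h₂ with
    | weak h' => exact h.deterministic h'
    | lam _ => cases h
  | lam _ ih =>
    cases h₂ with
    | weak h => cases h
    | lam hstep => rw [ih hstep]

/-- Terms `y M₁ … Mₘ` whose arguments `Mᵢ` satisfy `p`. -/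
inductive Neutral (p : Term → Prop) : Term → Prop
  | var (i : ℕ) : Neutral p (.var i)
  | app {H M : Term} : Neutral p H → p M → Neutral p (.app H M)

/-- Head normal forms `λx₁…xₙ. y M₁ … Mₘ` whose arguments `Mᵢ` satisfy `p`. -/
inductive Hnf (p : Term → Prop) : Term → Prop
  | neutral {H : Term} : Neutral p H → Hnf p H
  | lam {H : Term} : Hnf p H → Hnf p (.lam H)

theorem hnf_lams {p : Term → Prop} (n y : ℕ) (Ms : List Term) (h : ∀ M ∈ Ms, p M) :
    Hnf p (lams n (apps (.var y) Ms)) := by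
  induction n with
  | zero =>
    refine .neutral ?_
    simp only [lams]
    induction Ms using List.reverseRecOn with
    | nil => exact .var y
    | append_singleton Ms M ih =>
      rw [apps_concat]
      exact .app (ih fun M' hM' => h M' (by simp [hM'])) (h M (by simp))
  | succ n ih => exact .lam ih

theorem Hnf.isHnf {p : Term → Prop} {H : Term} (h : Hnf p H) : IsHnf H := by
  induction h with
  | neutral h =>
    suffices ∃ y Ms, _ = apps (.var y) Ms by
      obtain ⟨y, Ms, e⟩ := this
      exact ⟨0, y, Ms, e⟩
    induction h with
    | var i => exact ⟨i, [], rfl⟩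
    | app _ _ ih =>
      obtain ⟨y, Ms, rfl⟩ := ih
      exact ⟨y, Ms ++ [_], (apps_concat _ _ _).symm⟩
  | lam _ ih =>
    obtain ⟨n, y, Ms, rfl⟩ := ih
    exact ⟨n + 1, y, Ms, rfl⟩

theorem IsHnf.hnf {H : Term} (h : IsHnf H) : Hnf (fun _ => True) H := by
  obtain ⟨n, y, Ms, rfl⟩ := h
  exact hnf_lams n y Ms fun _ _ => trivial

theorem Neutral.not_weakHead {p : Term → Prop} {S : Term → Term → Prop} {H M : Term}
    (h : Neutral p H) : ¬ WeakHead S H M := by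
  induction h generalizing M with
  | var i => rintro ⟨⟩
  | app h _ ih =>
    intro h'
    cases h' with
    | beta _ => cases h
    | app _ h' => exact ih h'

theorem Hnf.not_head {p : Term → Prop} {S : Term → Term → Prop} {H M : Term}
    (h : Hnf p H) : ¬ Head S H M := by
  induction h generalizing M with
  | neutral h =>
    intro h'
    cases h' with
    | weak h' => exact h.not_weakHead h'
    | lam _ => cases h
  | lam _ ih =>
    intro h'
    cases h' with
    | weak h' => cases h'
    | lam h' => exact ih h'

/-- The function part of a neutral application stays neutral, hence never becomes an abstraction, so
the root is never contracted. The predicate is weakened to `True` because `p` need not be stable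
under reduction. -/
theorem Neutral.of_steps {p : Term → Prop} {n : ℕ} {H N : Term} (h : Neutral p H)
    (hN : Steps Beta n H N) : Neutral (fun _ => True) N := by
  induction h generalizing n N with
  | var i =>
    cases n with
    | zero => cases hN; exact .var i
    | succ n => obtain ⟨P, hP, -⟩ := hN; cases hP
  | app _ _ ih =>
    rcases hN.app_inv with ⟨a, b, M', A', -, rfl, ha, -⟩ | ⟨a, b, c, B, A', -, ha, -, -⟩
    · exact .app (ih ha) trivial
    · cases ih ha

theorem Hnf.of_steps {p : Term → Prop} {n : ℕ} {H N : Term} (h : Hnf p H)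
    (hN : Steps Beta n H N) : Hnf (fun _ => True) N := by
  induction h generalizing N with
  | neutral h => exact .neutral (h.of_steps hN)
  | lam _ ih =>
    obtain ⟨N', rfl, hN'⟩ := hN.lam_inv
    exact .lam (ih hN')

theorem Neutral.app_steps_inv {p : Term → Prop} {n : ℕ} {H A N : Term} (h : Neutral p H)
    (hN : Steps Beta n (.app H A) N) :
    ∃ a b H' A', a + b = n ∧ N = .app H' A' ∧ Steps Beta a H H' ∧ Steps Beta b A A' := by
  rcases hN.app_inv with h' | ⟨a, b, c, B, A', -, ha, -, -⟩
  · exact h'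
  · cases h.of_steps ha

theorem Steps.head_unique {S : Term → Term → Prop} {k k' : ℕ} {M H H' : Term}
    (h : Steps (Head S) k M H) (hH : IsHnf H) (h' : Steps (Head S) k' M H') (hH' : IsHnf H') :
    k = k' ∧ H = H' := by
  induction k generalizing k' M with
  | zero =>
    cases h
    cases k' with
    | zero => exact ⟨rfl, h'⟩
    | succ k' =>
      obtain ⟨P, hP, -⟩ := h'
      exact (hH.hnf.not_head hP).elim
  | succ k ih =>
    obtain ⟨P, hP, h⟩ := h
    cases k' with
    | zero =>
      cases h'
      exact (hH'.hnf.not_head hP).elim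
    | succ k' =>
      obtain ⟨P', hP', h'⟩ := h'
      cases hP.deterministic hP'
      obtain ⟨e, e'⟩ := ih h h'
      exact ⟨by omega, e'⟩

theorem headReduction_eq {k : ℕ} {M H : Term} (h : Steps (Head fun _ _ => True) k M H)
    (hH : IsHnf H) : headReduction M = (k, H) := by
  have spec := Classical.epsilon_spec
    (p := fun kH : ℕ × Term => Steps HeadStep kH.1 M kH.2 ∧ IsHnf kH.2)
    ⟨(k, H), h.map id headStep_iff.mpr, hH⟩
  obtain ⟨hk, hH⟩ := Steps.head_unique (spec.1.map id headStep_iff.mp) spec.2 h hH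
  exact Prod.ext hk hH

/-! ### Projecting a reduction over simple head steps -/

/-- The core of the argument: the two cases are whether the head redex survives in `N` or was
contracted on the way. In the second case that contraction is a step saved. -/
theorem WeakHead.project {M M' N : Term} {n : ℕ} (h : WeakHead SimpleRedex M M')
    (hN : Steps Beta n M N) :
    (∃ N' m, m ≤ n ∧ WeakHead (fun _ _ => True) N N' ∧ Steps Beta m M' N') ∨
      ∃ m, m + 1 ≤ n ∧ Steps Beta m M' N := by
  induction h generalizing n N with
  | beta hS =>
    rcases hN.app_inv with ⟨a, b, F, A, e, rfl, ha, hb⟩ | ⟨a, b, c, B, A, e, ha, hb, hc⟩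
    · obtain ⟨P', rfl, hP⟩ := ha.lam_inv
      obtain ⟨m, hm, h⟩ := hS.steps_inst hP hb
      exact .inl ⟨_, m, by omega, .beta trivial, h⟩
    · obtain ⟨P', hB, hP⟩ := ha.lam_inv
      cases hB
      obtain ⟨m, hm, h⟩ := hS.steps_inst hP hb
      exact .inr ⟨m + c, by omega, h.trans hc⟩
  | app A _ ih =>
    rcases hN.app_inv with ⟨a, b, F, A, e, rfl, ha, hb⟩ | ⟨a, b, c, B, A, e, ha, hb, hc⟩
    · rcases ih ha with ⟨N', m, hm, hw, h⟩ | ⟨m, hm, h⟩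
      · exact .inl ⟨_, m + b, by omega, .app A hw, h.app hb⟩
      · exact .inr ⟨m + b, by omega, h.app hb⟩
    · rcases ih ha with ⟨N', m, hm, hw, h⟩ | ⟨m, hm, h⟩
      -- Here the function part has reduced to an abstraction, which has no weak head step.
      · cases hw
      · exact .inr ⟨m + b + (1 + c), by omega,
          (h.app hb).trans ((Steps.single (.beta B A)).trans hc)⟩

theorem Head.project {M M' N : Term} {n : ℕ} (h : Head SimpleRedex M M')
    (hN : Steps Beta n M N) :
    (∃ N' m, m ≤ n ∧ Head (fun _ _ => True) N N' ∧ Steps Beta m M' N') ∨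
      ∃ m, m + 1 ≤ n ∧ Steps Beta m M' N := by
  induction h generalizing N with
  | weak h =>
    rcases h.project hN with ⟨N', m, hm, hw, h⟩ | h
    · exact .inl ⟨N', m, hm, .weak hw, h⟩
    · exact .inr h
  | lam _ ih =>
    obtain ⟨N₁, rfl, hN₁⟩ := hN.lam_inv
    rcases ih hN₁ with ⟨N', m, hm, hw, h⟩ | ⟨m, hm, h⟩
    · exact .inl ⟨_, m, hm, .lam hw, h.map Term.lam .lam⟩
    · exact .inr ⟨m, hm, h.map Term.lam .lam⟩

/-- Every head step of `M` that is missing in the head reduction of the reduct `N` uses up a step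
of the reduction from `M` to `N`. -/
theorem Steps.project_head {M H N : Term} {k n : ℕ} (h : Steps (Head SimpleRedex) k M H)
    (hN : Steps Beta n M N) :
    ∃ k' N' m, k' ≤ k ∧ m + k ≤ n + k' ∧ Steps (Head fun _ _ => True) k' N N' ∧
      Steps Beta m H N' := by
  induction k generalizing M N n with
  | zero =>
    cases h
    exact ⟨0, N, n, le_rfl, le_rfl, rfl, hN⟩
  | succ k ih =>
    obtain ⟨P, hP, h⟩ := h
    rcases hP.project hN with ⟨N', m, hm, hw, hm'⟩ | ⟨m, hm, hm'⟩
    · obtain ⟨k', N'', m', hk, hmk, hs, hb⟩ := ih h hm'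
      exact ⟨k' + 1, N'', m', by omega, by omega, ⟨N', hw, hs⟩, hb⟩
    · obtain ⟨k', N'', m', hk, hmk, hs, hb⟩ := ih h hm'
      exact ⟨k', N'', m', by omega, by omega, hs, hb⟩

/-- The hnf of a simple term, with its simple head reduction. -/
theorem Simple.exists_steps {M : Term} (hM : Simple M) (h : HasHnf M) :
    ∃ k H, Steps (Head SimpleRedex) k M H ∧ Hnf Simple H := by
  obtain ⟨X, hX, hMX⟩ := hM
  rcases hX M hMX with h' | ⟨k, n, y, Ms, hs, hMs⟩
  · exact (h' h).elim
  · exact ⟨k, _, hs.map id fun h => head_iff.mpr h,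
      hnf_lams n y Ms fun M' hM' => ⟨X, hX, hMs M' hM'⟩⟩

theorem hasHnf_of_steps {S : Term → Term → Prop} {k : ℕ} {M H : Term}
    (h : Steps (Head S) k M H) (hH : IsHnf H) : HasHnf M :=
  ⟨H, ⟨k, h.map id Head.beta_step⟩, hH⟩

theorem HasHnf.of_reduct {n : ℕ} {M N : Term} (h : Steps Beta n M N) (hN : HasHnf N) :
    HasHnf M := by
  obtain ⟨H, ⟨m, hm⟩, hH⟩ := hN
  exact ⟨H, ⟨n + m, h.trans hm⟩, hH⟩

/-! ### Trees related up to a bounded number of annotations -/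

/-- `R n T₁ T₂` implies that the roots of `T₁` and `T₂` have the same symbol and that the budget
`n` can be split among the children, less one if the root annotations differ. -/
def IsBudgeted (R : ℕ → AnnTree → AnnTree → Prop) : Prop :=
  ∀ n T₁ T₂, R n T₁ T₂ → T₁.dest.1.2 = T₂.dest.1.2 ∧
    ∃ (e : ℕ) (c : Fin 3 → ℕ), e + (c 0 + c 1 + c 2) ≤ n ∧
      (e = 0 → rootAnn T₁ = rootAnn T₂) ∧
      ∀ d h₁ h₂, R (c d) (T₁.dest.2 ⟨d, h₁⟩) (T₂.dest.2 ⟨d, h₂⟩)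

theorem dest_deannotate (T : AnnTree) :
    (deannotate T).dest = ⟨((), T.dest.1.2), fun d => deannotate (T.dest.2 d)⟩ :=
  PFunctor.M.dest_corec _ _

/-- With budgets and annotations forgotten, `R` is a bisimulation. -/
theorem IsBudgeted.deannotate_eq {R : ℕ → AnnTree → AnnTree → Prop} (hR : IsBudgeted R)
    {n : ℕ} {T₁ T₂ : AnnTree} (h : R n T₁ T₂) : deannotate T₁ = deannotate T₂ := by
  refine PFunctor.M.bisim
    (fun D₁ D₂ => ∃ n T₁ T₂, R n T₁ T₂ ∧ D₁ = deannotate T₁ ∧ D₂ = deannotate T₂) ?_ _ _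
    ⟨n, T₁, T₂, h, rfl, rfl⟩
  rintro _ _ ⟨n, T₁, T₂, h, rfl, rfl⟩
  obtain ⟨hs, e, c, -, -, hc⟩ := hR n T₁ T₂ h
  refine ⟨((), T₁.dest.1.2), fun d => deannotate (T₁.dest.2 d),
    fun d => deannotate (T₂.dest.2 ⟨d.1, hs ▸ d.2⟩), ?_, ?_, ?_⟩
  · exact dest_deannotate T₁
  · refine (dest_deannotate T₂).trans ?_
    -- The type of the children depends on the symbol, so the equation of symbols can be eliminated
    -- only once `T₂.dest` is a variable.
    generalize T₂.dest = D at hs hc ⊢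
    obtain ⟨⟨a, s⟩, f⟩ := D
    cases hs
    rfl
  · rintro ⟨d, hd⟩
    exact ⟨c d, _, _, hc d hd (hs ▸ hd), rfl, rfl⟩

theorem relAt_nil {T₁ T₂ : AnnTree} (h : rootAnn T₁ = rootAnn T₂) : RelAt Eq [] T₁ T₂ := by
  refine ⟨T₁, T₂, by simp [subtreeAt], by simp [subtreeAt], ?_⟩
  rw [← h]
  cases rootAnn T₁ with
  | none => exact .inl ⟨rfl, rfl⟩
  | some k => exact .inr ⟨k, k, rfl, rfl, rfl⟩

theorem cons_mem_differingPositions {T₁ T₂ : AnnTree} (hs : T₁.dest.1.2 = T₂.dest.1.2)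
    {d : Fin 3} {p : Position} (h : d :: p ∈ differingPositions T₁ T₂) :
    ∃ h₁ h₂, p ∈ differingPositions (T₁.dest.2 ⟨d, h₁⟩) (T₂.dest.2 ⟨d, h₂⟩) := by
  by_cases h₁ : d ∈ T₁.dest.1.2.dirs
  · have h₂ : d ∈ T₂.dest.1.2.dirs := hs ▸ h₁
    refine ⟨h₁, h₂, ?_⟩
    simpa [differingPositions, positions, RelAt, subtreeAt, h₁, h₂] using h
  · have h₂ : d ∉ T₂.dest.1.2.dirs := hs ▸ h₁
    simp [differingPositions, positions, subtreeAt, h₁, h₂] at h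

/-- The trees may be infinite, so the induction runs on a bound for the length of positions; the
estimate does not depend on that bound. -/
theorem IsBudgeted.encard_short_le {R : ℕ → AnnTree → AnnTree → Prop} (hR : IsBudgeted R)
    (l : ℕ) {n : ℕ} {T₁ T₂ : AnnTree} (h : R n T₁ T₂) :
    {p ∈ differingPositions T₁ T₂ | p.length < l}.encard ≤ n := by
  induction l generalizing n T₁ T₂ with
  | zero => simp
  | succ l ih =>
    obtain ⟨hs, e, c, hn, he, hc⟩ := hR n T₁ T₂ h
    -- `E` is the contribution of the root, paid for by `e`; `C d` collects the tails of the
    -- differing positions in direction `d`, paid for by `c d`.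
    let E : Set Position := {p | p = [] ∧ e ≠ 0}
    let C (d : Fin 3) : Set Position :=
      {p | d :: p ∈ differingPositions T₁ T₂ ∧ p.length < l}
    have hE : E.encard ≤ e := by
      by_cases h0 : e = 0
      · simp [E, h0]
      · calc E.encard ≤ ({[]} : Set Position).encard := Set.encard_le_encard fun p hp => hp.1
          _ = (1 : ℕ) := by simp
          _ ≤ e := by exact_mod_cast Nat.one_le_iff_ne_zero.mpr h0
    have hC : ∀ d, (List.cons d '' C d).encard ≤ c d := by
      intro d
      rw [List.cons_injective.encard_image]
      -- A member of `C d` shows that `d` is a direction of both roots, as is needed to speak of the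
      -- subtrees.
      rcases (C d).eq_empty_or_nonempty with h0 | ⟨p, hp, -⟩
      · simp [h0]
      · obtain ⟨h₁, h₂, -⟩ := cons_mem_differingPositions hs hp
        refine le_trans (Set.encard_le_encard fun q hq => ?_) (ih (hc d h₁ h₂))
        exact ⟨(cons_mem_differingPositions hs hq.1).2.2, hq.2⟩
    have hsub : {p ∈ differingPositions T₁ T₂ | p.length < l + 1} ⊆
        E ∪ (List.cons 0 '' C 0 ∪ List.cons 1 '' C 1 ∪ List.cons 2 '' C 2) := by
      rintro (_ | ⟨d, p⟩) ⟨hp, hl⟩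
      · exact .inl ⟨rfl, fun h0 => hp.2 (relAt_nil (he h0))⟩
      · have hd : d :: p ∈ List.cons d '' C d :=
          ⟨p, ⟨hp, by simpa using hl⟩, rfl⟩
        refine .inr ?_
        fin_cases d
        · exact .inl (.inl hd)
        · exact .inl (.inr hd)
        · exact .inr hd
    calc _ ≤ _ := Set.encard_le_encard hsub
      _ ≤ E.encard + ((List.cons 0 '' C 0).encard + (List.cons 1 '' C 1).encard +
          (List.cons 2 '' C 2).encard) :=
        (Set.encard_union_le _ _).trans (add_le_add le_rfl
          ((Set.encard_union_le _ _).trans (add_le_add (Set.encard_union_le _ _) le_rfl)))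
      _ ≤ (e : ℕ∞) + (c 0 + c 1 + c 2) :=
        add_le_add hE (add_le_add (add_le_add (hC 0) (hC 1)) (hC 2))
      _ ≤ n := by exact_mod_cast hn

theorem IsBudgeted.encard_le {R : ℕ → AnnTree → AnnTree → Prop} (hR : IsBudgeted R)
    {n : ℕ} {T₁ T₂ : AnnTree} (h : R n T₁ T₂) : (differingPositions T₁ T₂).encard ≤ n := by
  by_contra! hlt
  -- Any `n + 1` differing positions are of bounded length, so the bound for short positions already
  -- refutes them.
  obtain ⟨F, hF, hcard⟩ := Set.exists_subset_encard_eq (Order.add_one_le_of_lt hlt)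
  have hfin : F.Finite := Set.finite_of_encard_eq_coe (k := n + 1) (by exact_mod_cast hcard)
  obtain ⟨l, hl⟩ := (hfin.image List.length).bddAbove
  have hle : F.encard ≤ n :=
    (Set.encard_le_encard (t := {p ∈ differingPositions T₁ T₂ | p.length < l + 1})
      fun p hp => ⟨hF hp, Nat.lt_succ_of_le (hl ⟨p, hp, rfl⟩)⟩).trans
      (hR.encard_short_le (l + 1) h)
  rw [hcard] at hle
  have : n + 1 ≤ n := by exact_mod_cast hle
  omega

theorem relEventually_of_finite {T₁ T₂ : AnnTree} (h : deannotate T₁ = deannotate T₂)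
    (hfin : (differingPositions T₁ T₂).Finite) : RelEventually Eq T₁ T₂ := by
  obtain ⟨l, hl⟩ := (hfin.image List.length).bddAbove
  refine ⟨h, l + 1, fun p hp hlen => ?_⟩
  by_contra hrel
  have : p.length ≤ l := hl ⟨p, ⟨.inl hp, hrel⟩, rfl⟩
  omega

/-! ### Clocked Böhm trees of reducts of simple terms -/

/-- The second state is reached from the first by a reduction of at most `n` steps, where all
terms still to be evaluated in the first state are simple. -/
inductive StateRel (n : ℕ) : State → State → Prop
  | eval {m : ℕ} {M N : Term} : Simple M → m ≤ n → Steps Beta m M N →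
      StateRel n (.eval M) (.eval N)
  | inner {m : ℕ} {H K : Term} : Hnf Simple H → m ≤ n → Steps Beta m H K →
      StateRel n (.inner H) (.inner K)

/-- The two outputs have the same symbol and annotations equal if `e = 0`, and the budget `n` can
be split among `e` and the children. -/
def OutputRel (n e : ℕ) (x y : (treeF (Option ℕ)) State) : Prop :=
  x.1.2 = y.1.2 ∧ (e = 0 → x.1.1 = y.1.1) ∧ ∃ c : Fin 3 → ℕ, e + (c 0 + c 1 + c 2) ≤ n ∧
    ∀ d h₁ h₂, StateRel (c d) (x.2 ⟨d, h₁⟩) (y.2 ⟨d, h₂⟩)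

/-- Steps from an hnf never contract a redex at its spine, so they distribute over the children of
the root. -/
theorem Hnf.emit_rel {H H' : Term} {m n e : ℕ} (h : Hnf Simple H) (hH : Steps Beta m H H')
    (hn : e + m ≤ n) {a b : Option ℕ} (hab : e = 0 → a = b) :
    OutputRel n e (emit a H) (emit b H') := by
  cases h with
  | neutral h =>
    cases h with
    | var i =>
      cases m with
      | zero =>
        cases hH
        exact ⟨rfl, hab, fun _ => 0, by omega, fun d h₁ => (Set.notMem_empty d h₁).elim⟩
      | succ m => obtain ⟨P, hP, -⟩ := hH; cases hP
    | app h hA =>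
      obtain ⟨k, l, H', A', e, rfl, hk, hl⟩ := h.app_steps_inv hH
      -- Function and argument receive the numbers of steps made inside them; direction `0` does not
      -- occur at an application.
      refine ⟨rfl, hab, ![0, k, l], ?_, fun d h₁ h₂ => ?_⟩
      · change _ + (0 + k + l) ≤ n
        omega
      · rcases h₁ with rfl | rfl
        · exact .inner (.neutral h) le_rfl hk
        · exact .eval hA le_rfl hl
  | lam h =>
    obtain ⟨H', rfl, hH'⟩ := hH.lam_inv
    refine ⟨rfl, hab, ![m, 0, 0], ?_, fun d h₁ h₂ => ?_⟩
    · change _ + (m + 0 + 0) ≤ n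
      omega
    · obtain rfl : d = 0 := h₁
      exact .inner h le_rfl hH'

theorem cbtStep_eval_of_steps {k : ℕ} {M H : Term} (h : Steps (Head fun _ _ => True) k M H)
    (hH : IsHnf H) : cbtStep (.eval M) = emit (some k) H := by
  refine (if_pos (hasHnf_of_steps h hH)).trans ?_
  rw [headReduction_eq h hH]

theorem cbtStep_eval_of_not_hasHnf {M : Term} (h : ¬ HasHnf M) :
    cbtStep (.eval M) = ⟨(none, .bot), fun d => (Set.notMem_empty d.1 d.2).elim⟩ :=
  if_neg h

theorem StateRel.cbtStep_rel {n : ℕ} {s t : State} (h : StateRel n s t) :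
    ∃ e, OutputRel n e (cbtStep s) (cbtStep t) := by
  cases h with
  | @eval m M N hM hm hN =>
    by_cases hh : HasHnf M
    · obtain ⟨k, H, hk, hH⟩ := hM.exists_steps hh
      obtain ⟨k', N', m', hk', hmk, hN', hm'⟩ := hk.project_head hN
      have hN'h := (hH.of_steps hm').isHnf
      have hkT : Steps (Head fun _ _ => True) k M H := hk.map id fun h => by
        rw [head_iff] at h ⊢
        obtain ⟨P, Q, -, h⟩ := h
        exact ⟨P, Q, trivial, h⟩
      -- The root pays for the head steps missing in `N`; since `k' ≤ k`, a zero payment means equal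
      -- annotations.
      refine ⟨k - k', ?_⟩
      rw [cbtStep_eval_of_steps hkT hH.isHnf, cbtStep_eval_of_steps hN' hN'h]
      exact hH.emit_rel hm' (by omega) fun h0 => congrArg some (by omega)
    -- An hnf of `N` would also be a reduct of `M`.
    · have hh' : ¬ HasHnf N := fun h' => hh (h'.of_reduct hN)
      refine ⟨0, ?_⟩
      rw [cbtStep_eval_of_not_hasHnf hh, cbtStep_eval_of_not_hasHnf hh']
      exact ⟨rfl, fun _ => rfl, fun _ => 0, Nat.zero_le n, fun d h₁ => (Set.notMem_empty d h₁).elim⟩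
  | inner hH hm hs => exact ⟨0, hH.emit_rel hs (by omega) fun _ => rfl⟩

/-- Trees generated from related states. -/
def TreeRel (n : ℕ) (T₁ T₂ : AnnTree) : Prop :=
  ∃ s t, StateRel n s t ∧ T₁ = PFunctor.M.corec cbtStep s ∧ T₂ = PFunctor.M.corec cbtStep t

theorem isBudgeted_treeRel : IsBudgeted TreeRel := by
  rintro n _ _ ⟨s, t, h, rfl, rfl⟩
  obtain ⟨e, hs, ha, c, hc, hd⟩ := h.cbtStep_rel
  rw [rootAnn, rootAnn, PFunctor.M.dest_corec, PFunctor.M.dest_corec]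
  exact ⟨hs, e, c, hc, ha, fun d h₁ h₂ => ⟨_, _, hd d h₁ h₂, rfl, rfl⟩⟩

end ClockedBohm

theorem mainTheorem4 (M N : ClockedBohm.Term) (hM : ClockedBohm.Simple M)
    (hMN : ClockedBohm.Reduces M N) :
    ClockedBohm.MatchesEventually M N ∧
      (ClockedBohm.differingPositions
        (ClockedBohm.clockedBohmTree M) (ClockedBohm.clockedBohmTree N)).Finite ∧
      ∀ n : ℕ, ClockedBohm.Steps ClockedBohm.Beta n M N →
        (ClockedBohm.differingPositions
          (ClockedBohm.clockedBohmTree M) (ClockedBohm.clockedBohmTree N)).ncard ≤ n := by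
  have rel : ∀ n, ClockedBohm.Steps ClockedBohm.Beta n M N → ClockedBohm.TreeRel n
      (ClockedBohm.clockedBohmTree M) (ClockedBohm.clockedBohmTree N) :=
    fun n hn => ⟨_, _, .eval hM le_rfl hn, rfl, rfl⟩
  obtain ⟨n, hn⟩ := hMN
  have hfin := Set.finite_of_encard_le_coe
    (ClockedBohm.isBudgeted_treeRel.encard_le (rel n hn))
  refine ⟨ClockedBohm.relEventually_of_finite
    (ClockedBohm.isBudgeted_treeRel.deannotate_eq (rel n hn)) hfin, hfin, fun n hn => ?_⟩
  have := ClockedBohm.isBudgeted_treeRel.encard_le (rel n hn)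
  rw [← hfin.cast_ncard_eq] at this
  exact_mod_cast this
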